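/- Let $K$ be a number field with algebraic closure $\overline{\mathbb Q}$, and write $G_L=\mathrm{Gal}(\overline{\mathbb Q}/L)$ for an intermediate field $L$. Let $A/K$ be a Ribet–Pyle abelian variety: $X=\mathrm{End}_{\overline{\mathbb Q}}(A)\otimes\mathbb Q$ is a simple algebra and $E=\mathrm{End}_K(A)\otimes\mathbb Q$ is a maximal subfield of $X$ (a subfield equal to its own centralizer); for example, $A=A_f$ for a non-CM Hilbert newform $f$ of parallel weight $2$ over a totally real field $K$ of odd degree. Let $F\subseteq E$ be the centre of $X$, fix an embedding of $E$ in $\overline{\mathbb Q}$, and let $FK\subseteq\overline{\mathbb Q}$ be the compositum of $F$ and $K$. Let $\sigma\mapsto\alpha(\sigma)\in X^\times$ be a locally constant map on $G_K$ such that every $\sigma\in G_K$ acts on $X$ as conjugation by $\alpha(\sigma)$ (necessarily $\alpha(\sigma)\in E^\times$), where $\sigma(\phi)(x)=\sigma(\phi(\sigma^{-1}x))$ for $\phi\in\mathrm{End}_{\overline{\mathbb Q}}(A)$. Let $c_\alpha(\sigma,\tau)=\alpha(\sigma)\alpha(\tau)\alpha(\sigma\tau)^{-1}$, a $2$-cocycle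 with values in $F^\times$ with trivial action, and consider $$H^2(G_K,F^\times)\xrightarrow{\ \mathrm{res}\ }H^2(G_{FK},F^\times)\xrightarrow{\ \iota_*\ }H^2(G_{FK},\overline{\mathbb Q}^\times)=\mathrm{Br}(FK),$$ where $\iota_*$ is induced by $F^\times\subseteq\overline{\mathbb Q}^\times$. Suppose that the field $N$ cut out by the kernel $\{\sigma\in G_K:\alpha(\sigma)^2\in (F^{\times})^2\}=G_N$ of $\alpha^2$ is $N=K(\sqrt{t_1},\dots,\sqrt{t_m})$ with $t_i\in K^\times$ (for $A_f$ this holds when the central character of $f$ is trivial), and let $\sigma_1,\dots,\sigma_m\in G_K$ satisfy $\sigma_i(\sqrt{t_j})=(-1)^{\delta_{ij}}\sqrt{t_j}$ for all $i,j$. Then $\alpha(\sigma_i)^2\in F^\times$ for every $i$, and in $\mathrm{Br}(FK)$ one has $$\iota_*(\mathrm{res}([c_\alpha]))=\prod_{i=1}^m\bigl(t_i,\alpha(\sigma_i)^2\bigr)_{FK},$$ where $(a,b)_{FK}$ is the Hilbert symbol, that is, the class in $\mathrm{Br}(FK)$ of the quaternion algebra over $FK$ with $i^2=a$, $j^2=b$,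 $ij=-ji$. -/

import Mathlib

universe v u
namespace GalCoh
variable {G G' M M' : Type*} [Group G] [TopologicalSpace G] [Group G'] [TopologicalSpace G']
  [CommGroup M] [CommGroup M']

/-- Continuous 2-cocycles of a topological group `G` with values in a discrete `G`-module `M`
(written multiplicatively, with action `ρ`); continuous means locally constant. -/
def cocycles₂ (ρ : G →* MulAut M) : Subgroup (G × G → M) where
  carrier := {c | IsLocallyConstant c ∧
    ∀ g h k, c (g * h, k) * c (g, h) = ρ g (c (h, k)) * c (g, h * k)}
  one_mem' := ⟨IsLocallyConstant.const 1, fun g h k => by simp⟩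
  mul_mem' := by
    rintro a b ⟨ha, ha'⟩ ⟨hb, hb'⟩
    refine ⟨ha.mul hb, fun g h k => ?_⟩
    simp only [Pi.mul_apply, map_mul]
    rw [mul_mul_mul_comm, ha', hb', mul_mul_mul_comm]
  inv_mem' := by
    rintro a ⟨ha, ha'⟩
    refine ⟨ha.inv, fun g h k => ?_⟩
    simp only [Pi.inv_apply, map_inv]
    rw [← mul_inv, ha', mul_inv]

/-- Coboundaries of continuous (that is, locally constant) 1-cochains. -/
def coboundaries₂ (ρ : G →* MulAut M) : Subgroup (cocycles₂ ρ) where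
  carrier := {c | ∃ b : G → M, IsLocallyConstant b ∧
    ∀ g h, c.1 (g, h) = ρ g (b h) * b g / b (g * h)}
  one_mem' := ⟨1, IsLocallyConstant.const 1, fun g h => by simp⟩
  mul_mem' := by
    rintro a b ⟨x, hx, hx'⟩ ⟨y, hy, hy'⟩
    refine ⟨x * y, hx.mul hy, fun g h => ?_⟩
    simp only [Subgroup.coe_mul, Pi.mul_apply, map_mul, hx', hy']
    rw [div_mul_div_comm, mul_mul_mul_comm]
  inv_mem' := by
    rintro a ⟨x, hx, hx'⟩
    refine ⟨x⁻¹, hx.inv, fun g h => ?_⟩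
    simp only [Subgroup.coe_inv, Pi.inv_apply, map_inv, hx']
    rw [inv_div, div_eq_mul_inv, mul_comm, ← mul_inv, div_inv_eq_mul]

/-- The continuous cohomology group `H²(G, M)` for a discrete `G`-module `M`. -/
abbrev H2 (ρ : G →* MulAut M) := cocycles₂ ρ ⧸ coboundaries₂ ρ

/-- The map on cocycles induced by a continuous homomorphism `f : G' → G` and a compatible
homomorphism of coefficients `φ : M → M'`. -/
def cocyclesMap {ρ : G →* MulAut M} {ρ' : G' →* MulAut M'} (f : G' →* G) (hf : Continuous f)
    (φ : M →* M') (h : ∀ g m, φ (ρ (f g) m) = ρ' g (φ m)) :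
    cocycles₂ ρ →* cocycles₂ ρ' where
  toFun c := ⟨fun p => φ (c.1 (f p.1, f p.2)),
    (c.2.1.comp_continuous (hf.prodMap hf)).comp φ, fun g k l => by
      have := congrArg φ (c.2.2 (f g) (f k) (f l))
      simpa only [map_mul, h] using this⟩
  map_one' := by ext; simp
  map_mul' a b := by ext; simp

/-- The map `H²(G, M) → H²(G', M')` induced by a compatible pair. -/
def H2.map {ρ : G →* MulAut M} {ρ' : G' →* MulAut M'} (f : G' →* G) (hf : Continuous f)
    (φ : M →* M') (h : ∀ g m, φ (ρ (f g) m) = ρ' g (φ m)) : H2 ρ →* H2 ρ' :=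
  QuotientGroup.map _ _ (cocyclesMap f hf φ h) (by
    rintro c ⟨b, hb, hb'⟩
    refine ⟨fun g => φ (b (f g)), (hb.comp_continuous hf).comp φ, fun g k => ?_⟩
    change φ (c.1 (f g, f k)) = _
    simp only [hb', map_div, map_mul, h])

end GalCoh

section Brauer
open scoped TensorProduct Quaternion
open GalCoh

/-- The action of `Gal(Ω/k)` on `Ωˣ`. -/
def galUnits (k Ω : Type*) [Field k] [Field Ω] [Algebra k Ω] :
    (Ω ≃ₐ[k] Ω) →* MulAut Ωˣ where
  toFun σ := Units.mapEquiv (σ : Ω ≃* Ω)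
  map_one' := by ext; rfl
  map_mul' _ _ := by ext; rfl

/-- The Brauer group of `k` as the Galois cohomology group `H²(Gal(Ω/k), Ωˣ)`, for an algebraic
closure `Ω` of `k`. `HasBrauerClass` says which element is the class of a central simple algebra;
the group law is tensor product of algebras. -/
abbrev Br (k Ω : Type*) [Field k] [Field Ω] [Algebra k Ω] := H2 (galUnits k Ω)

variable (k : Type*) {Ω : Type*} [Field k] [Field Ω] [Algebra k Ω]

/-- `x` is the class of the central simple `k`-algebra `B`: choose a splitting
`e : Ω ⊗ B ≃ Mₙ(Ω)`. The natural Galois action on `Ω ⊗ B` corresponds to `X ↦ P σ * σ(X) * (P σ)⁻¹`,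
so that `P` is a 1-cocycle with values in `PGLₙ(Ω)`, and `x` is its image under the connecting map
`H¹(PGLₙ(Ω)) → H²(Ωˣ)`, namely the class of `P σ * σ(P τ) * (P (σ τ))⁻¹`. -/
def HasBrauerClass (B : Type*) [Ring B] [Algebra k B] (x : Br k Ω) : Prop :=
  ∃ (n : ℕ) (e : Ω ⊗[k] B ≃ₐ[Ω] Matrix (Fin n) (Fin n) Ω)
    (P : (Ω ≃ₐ[k] Ω) → GL (Fin n) Ω) (c : cocycles₂ (galUnits k Ω)),
    n ≠ 0 ∧ IsLocallyConstant P ∧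
    (∀ σ (b : B), e (1 ⊗ₜ b) = (P σ).val * (e (1 ⊗ₜ b)).map σ * (P σ)⁻¹.val) ∧
    (∀ σ τ, (P σ).val * (P τ).val.map σ = (c.1 (σ, τ)).val • (P (σ * τ)).val) ∧
    x = QuotientGroup.mk c

variable {k}

theorem isLocallyConstant_apply [Algebra.IsAlgebraic k Ω] (r : Ω) :
    IsLocallyConstant (fun σ : Ω ≃ₐ[k] Ω => σ r) := by
  rw [IsLocallyConstant.iff_isOpen_fiber_apply]
  intro σ
  have h := stabilizer_isOpen_of_isIntegral (K := k) r
  have : (fun τ : Ω ≃ₐ[k] Ω => τ r) ⁻¹' {σ r} =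
      (fun τ => σ⁻¹ * τ) ⁻¹' (MulAction.stabilizer (Ω ≃ₐ[k] Ω) r : Set (Ω ≃ₐ[k] Ω)) := by
    ext τ
    simp only [Set.mem_preimage, Set.mem_singleton_iff, SetLike.mem_coe, MulAction.mem_stabilizer_iff,
      AlgEquiv.smul_def, AlgEquiv.mul_apply]
    constructor
    · intro h; rw [h]; exact σ.symm_apply_apply r
    · intro h; exact (σ.apply_symm_apply (τ r)).symm.trans (congrArg σ h)
  rw [this]
  exact h.preimage (continuous_const_mul _)

theorem exists_conj {n : ℕ} (ε : Matrix (Fin n) (Fin n) Ω ≃ₐ[Ω] Matrix (Fin n) (Fin n) Ω) :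
    ∃ Q : GL (Fin n) Ω, ∀ X, ε X = Q.val * X * Q⁻¹.val := by
  obtain ⟨T, hT⟩ := AlgEquiv.eq_linearEquivConjAlgEquiv
    ((Matrix.toLinAlgEquiv'.symm.trans ε).trans Matrix.toLinAlgEquiv')
  refine ⟨⟨LinearMap.toMatrix' T.toLinearMap, LinearMap.toMatrix' T.symm.toLinearMap, ?_, ?_⟩,
    fun X => ?_⟩
  · rw [← LinearMap.toMatrix'_comp]; simp
  · rw [← LinearMap.toMatrix'_comp]; simp
  · have h := congrArg LinearMap.toMatrix' (DFunLike.congr_fun hT (Matrix.toLin' X))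
    have h1 : (((Matrix.toLinAlgEquiv'.symm.trans ε).trans Matrix.toLinAlgEquiv')
        (Matrix.toLin' X)) = Matrix.toLin' (ε X) := by
      change Matrix.toLin' (ε (LinearMap.toMatrix' (Matrix.toLin' X))) = _
      rw [LinearMap.toMatrix'_toLin']
    rw [h1, LinearMap.toMatrix'_toLin', LinearEquiv.conjAlgEquiv_apply, LinearMap.toMatrix'_comp,
      LinearMap.toMatrix'_comp, LinearMap.toMatrix'_toLin'] at h
    rw [h, Matrix.mul_assoc]
    rfl

/-- An algebra has at most one Brauer class. -/
theorem HasBrauerClass.unique [Algebra.IsAlgebraic k Ω] {B : Type*} [Ring B] [Algebra k B]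
    {x y : Br k Ω} (hx : HasBrauerClass k B x) (hy : HasBrauerClass k B y) : x = y := by
  obtain ⟨n, e, P, c, hn, hP, hPe, hPc, rfl⟩ := hx
  obtain ⟨n', e', P', c', hn', hP', hPe', hPc', rfl⟩ := hy
  have hnn : n = n' := by
    have := (e.symm.trans e').toLinearEquiv.finrank_eq
    simp only [Module.finrank_matrix, Fintype.card_fin, Module.finrank_self, mul_one] at this
    exact Nat.mul_self_inj.mp this
  subst hnn
  obtain ⟨Q, hQ⟩ := exists_conj (e.symm.trans e')
  have hQ' : ∀ b : B, e' (1 ⊗ₜ b) = Q.val * e (1 ⊗ₜ b) * Q⁻¹.val := fun b => by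
    rw [← hQ]; simp
  let s (σ : Ω ≃ₐ[k] Ω) : GL (Fin n) Ω →* GL (Fin n) Ω :=
    Matrix.GeneralLinearGroup.map (σ : Ω →+* Ω)
  have hs (σ : Ω ≃ₐ[k] Ω) (g : GL (Fin n) Ω) : (s σ g).val = g.val.map σ := rfl
  let N (σ : Ω ≃ₐ[k] Ω) : GL (Fin n) Ω := Q⁻¹ * P' σ * s σ Q * (P σ)⁻¹
  have hN (σ : Ω ≃ₐ[k] Ω) : ∃ d : Ω, (N σ).val = d • 1 := by
    have h1 (b : B) : Commute (N σ).val (e (1 ⊗ₜ b)) := by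
      have h2 := hPe' σ b
      rw [hQ' b, Matrix.map_mul, Matrix.map_mul, ← hs, ← hs, map_inv] at h2
      set m := e (1 ⊗ₜ[k] b) with hm
      have h3 : m.map σ = (P σ)⁻¹.val * m * (P σ).val := by
        have h3' : (P σ).val * m.map σ * (P σ)⁻¹.val = m := (hPe σ b).symm
        rw [← congrArg (fun y => (P σ)⁻¹.val * y * (P σ).val) h3']
        simp only [← mul_assoc, Units.inv_mul, one_mul]
        rw [mul_assoc, Units.inv_mul, mul_one]
      rw [h3] at h2
      have h4 : m = (N σ).val * m * (N σ)⁻¹.val := by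
        calc m = Q⁻¹.val * (Q.val * m * Q⁻¹.val) * Q.val := by
              simp only [← mul_assoc, Units.inv_mul, one_mul]
              rw [mul_assoc, Units.inv_mul, mul_one]
          _ = _ := by
              rw [h2]
              simp only [N, mul_inv_rev, inv_inv, Units.val_mul, mul_assoc]
      rw [Commute, SemiconjBy]
      conv_rhs => rw [h4]
      rw [mul_assoc _ (N σ)⁻¹.val, Units.inv_mul, mul_one]
    have h5 (X : Matrix (Fin n) (Fin n) Ω) : Commute (N σ).val X := by
      obtain ⟨z, rfl⟩ := e.surjective X
      induction z with
      | zero => simp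
      | add u v hu hv => rw [map_add]; exact hu.add_right hv
      | tmul r b =>
        have : r ⊗ₜ[k] b = r • ((1 : Ω) ⊗ₜ[k] b) := by simp [TensorProduct.smul_tmul']
        rw [this, map_smul]
        exact (h1 b).smul_right r
    obtain ⟨d, hd⟩ := Matrix.mem_range_scalar_of_commute_single
      (M := (N σ).val) (fun i j _ => (h5 _).symm)
    exact ⟨d, by rw [← hd, Matrix.scalar_apply, Matrix.smul_one_eq_diagonal]⟩
  choose d hd using hN
  have i0 : Fin n := ⟨0, Nat.pos_of_ne_zero hn⟩
  have hd0 (σ : Ω ≃ₐ[k] Ω) : d σ ≠ 0 := by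
    intro h0
    have h1 := (N σ).mul_inv
    rw [hd, h0, zero_smul, zero_mul] at h1
    simpa using congrFun (congrFun h1 i0) i0
  have hdN (σ : Ω ≃ₐ[k] Ω) : d σ = (N σ).val i0 i0 := by simp [hd]
  have hsQ : IsLocallyConstant (fun σ : Ω ≃ₐ[k] Ω => s σ Q) := by
    rw [IsLocallyConstant.iff_eventually_eq]
    intro σ
    have : ∀ᶠ τ in nhds σ, ∀ p : Fin n × Fin n, τ (Q.val p.1 p.2) = σ (Q.val p.1 p.2) :=
      Filter.eventually_all.2 fun p =>
        (isLocallyConstant_apply (Q.val p.1 p.2)).eventually_eq σ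
    filter_upwards [this] with τ hτ
    ext i j
    exact hτ (i, j)
  have hNl : IsLocallyConstant N :=
    (((IsLocallyConstant.const Q⁻¹).mul hP').mul hsQ).mul hP.inv
  have hdl : IsLocallyConstant d := by
    have := hNl.comp (fun g => g.val i0 i0)
    exact (funext hdN : d = _) ▸ this
  let D (σ : Ω ≃ₐ[k] Ω) : Ωˣ := Units.mk0 (d σ) (hd0 σ)
  have hD : IsLocallyConstant D := by
    rw [IsLocallyConstant.iff_eventually_eq] at hdl ⊢
    intro σ
    filter_upwards [hdl σ] with τ hτ
    exact Units.ext hτ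
  have key (σ : Ω ≃ₐ[k] Ω) : (P' σ).val * (s σ Q).val = d σ • (Q.val * (P σ).val) := by
    have h1 : P' σ * s σ Q = Q * N σ * P σ := by simp [N, mul_assoc]
    rw [← Units.val_mul, h1, Units.val_mul, Units.val_mul, hd]
    simp
  have key₂ (σ τ : Ω ≃ₐ[k] Ω) :
      (c'.1 (σ, τ)).val * d (σ * τ) = σ (d τ) * d σ * (c.1 (σ, τ)).val := by
    have hmul : s (σ * τ) Q = s σ (s τ Q) := rfl
    have e1 : (P' σ).val * (s σ (P' τ)).val * (s (σ * τ) Q).val =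
        ((c'.1 (σ, τ)).val * d (σ * τ)) • (Q.val * (P (σ * τ)).val) := by
      rw [hs σ (P' τ), hPc', smul_mul_assoc, key, smul_smul]
    have e2 : (P' σ).val * (s σ (P' τ)).val * (s (σ * τ) Q).val =
        (σ (d τ) * d σ * (c.1 (σ, τ)).val) • (Q.val * (P (σ * τ)).val) := by
      have h1 : (s σ (P' τ)).val * (s (σ * τ) Q).val =
          σ (d τ) • ((s σ Q).val * (s σ (P τ)).val) := by
        rw [hmul, ← Units.val_mul, ← map_mul, hs, Units.val_mul, key, Matrix.map_smul' _ _ _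
          (map_mul σ), Matrix.map_mul]
        rfl
      rw [mul_assoc, h1, mul_smul_comm, ← mul_assoc, key, smul_mul_assoc, smul_smul, mul_assoc,
        hs σ (P τ), hPc, mul_smul_comm, smul_smul]
    have e3 := e1.symm.trans e2
    by_contra hne
    have h4 : ((c'.1 (σ, τ)).val * d (σ * τ) - σ (d τ) * d σ * (c.1 (σ, τ)).val) •
        (Q * P (σ * τ)).val = 0 := by
      rw [sub_smul, Units.val_mul, e3, sub_self]
    rcases smul_eq_zero.mp h4 with h5 | h5
    · exact hne (sub_eq_zero.mp h5)
    · have h6 := (Q * P (σ * τ)).mul_inv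
      rw [h5, zero_mul] at h6
      simpa using congrFun (congrFun h6 i0) i0
  rw [QuotientGroup.eq]
  refine ⟨D, hD, fun σ τ => ?_⟩
  change (c.1 (σ, τ))⁻¹ * c'.1 (σ, τ) = _
  rw [eq_div_iff_mul_eq', mul_assoc, inv_mul_eq_iff_eq_mul]
  exact Units.ext ((key₂ σ τ).trans (mul_comm _ _))

theorem exists_quaternion_rep (a b : kˣ) (r : Ω) (hr : r ^ 2 = algebraMap k Ω a) :
    ∃ φ : ℍ[k, (a : k), (b : k)] →ₐ[k] Matrix (Fin 2) (Fin 2) Ω, ∀ x, φ x =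
      !![algebraMap k Ω x.re + algebraMap k Ω x.imI * r,
        algebraMap k Ω x.imJ * algebraMap k Ω b + algebraMap k Ω x.imK * (r * algebraMap k Ω b);
        algebraMap k Ω x.imJ - algebraMap k Ω x.imK * r,
        algebraMap k Ω x.re - algebraMap k Ω x.imI * r] := by
  set β : Ω := algebraMap k Ω b with hβ
  let q : QuaternionAlgebra.Basis (Matrix (Fin 2) (Fin 2) Ω) (a : k) 0 (b : k) :=
    { i := !![r, 0; 0, -r]
      j := !![0, β; 1, 0]
      k := !![0, r * β; -r, 0]
      i_mul_i := by
        ext i j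
        fin_cases i <;> fin_cases j <;>
          simp [Matrix.mul_apply, Fin.sum_univ_two, ← pow_two, hr] <;>
          simp [Algebra.smul_def]
      j_mul_j := by
        ext i j
        fin_cases i <;> fin_cases j <;>
          simp [Matrix.mul_apply, Fin.sum_univ_two, hβ] <;>
          simp [Algebra.smul_def]
      i_mul_j := by
        ext i j
        fin_cases i <;> fin_cases j <;>
          simp [Matrix.mul_apply, Fin.sum_univ_two]
      j_mul_i := by
        ext i j
        fin_cases i <;> fin_cases j <;>
          simp [Matrix.mul_apply, Fin.sum_univ_two, mul_comm] }
  refine ⟨q.liftHom, fun x => ?_⟩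
  change q.lift x = _
  ext i j
  fin_cases i <;> fin_cases j <;>
    simp [QuaternionAlgebra.Basis.lift, q, Matrix.algebraMap_matrix_apply, sub_eq_add_neg] <;>
    simp [Algebra.smul_def]

theorem exists_quaternion_splitting (a b : kˣ) (r : Ω) (hr : r ^ 2 = algebraMap k Ω a)
    (hr0 : r ≠ 0) (h2 : (2 : Ω) ≠ 0) :
    ∃ e : Ω ⊗[k] ℍ[k, (a : k), (b : k)] ≃ₐ[Ω] Matrix (Fin 2) (Fin 2) Ω, ∀ x, e (1 ⊗ₜ x) =
      !![algebraMap k Ω x.re + algebraMap k Ω x.imI * r,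
        algebraMap k Ω x.imJ * algebraMap k Ω b + algebraMap k Ω x.imK * (r * algebraMap k Ω b);
        algebraMap k Ω x.imJ - algebraMap k Ω x.imK * r,
        algebraMap k Ω x.re - algebraMap k Ω x.imI * r] := by
  obtain ⟨φ, hφ⟩ := exists_quaternion_rep a b r hr
  set β : Ω := algebraMap k Ω b with hβ
  have hβ0 : β ≠ 0 := (map_ne_zero _).2 b.ne_zero
  let Φ : Ω ⊗[k] ℍ[k, (a : k), (b : k)] →ₐ[Ω] Matrix (Fin 2) (Fin 2) Ω :=
    Algebra.TensorProduct.lift (Algebra.ofId Ω _) φ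
      (fun x y => Algebra.commutes x (φ y))
  have hΦ (y) : Φ (1 ⊗ₜ y) = φ y :=
    (Algebra.TensorProduct.lift_tmul _ _ _ _ _).trans (by rw [map_one, one_mul])
  have hΦs (z : Ω) (y) : Φ (z ⊗ₜ y) = z • φ y := by
    rw [← hΦ, ← map_smul, TensorProduct.smul_tmul', smul_eq_mul, mul_one]
  have hsurj : Function.Surjective Φ := by
    intro X
    have hI : φ ⟨0, 1, 0, 0⟩ = !![r, 0; 0, -r] := by rw [hφ]; simp
    have hJ : φ ⟨0, 0, 1, 0⟩ = !![0, β; 1, 0] := by rw [hφ]; simp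
    have hK : φ ⟨0, 0, 0, 1⟩ = !![0, r * β; -r, 0] := by rw [hφ]; simp
    refine ⟨((X 0 0 + X 1 1) / 2) ⊗ₜ 1 + ((X 0 0 - X 1 1) / (2 * r)) ⊗ₜ ⟨0, 1, 0, 0⟩ +
      ((X 0 1 / β + X 1 0) / 2) ⊗ₜ ⟨0, 0, 1, 0⟩ +
      ((X 0 1 / β - X 1 0) / (2 * r)) ⊗ₜ ⟨0, 0, 0, 1⟩, ?_⟩
    rw [map_add, map_add, map_add, hΦs, hΦs, hΦs, hΦs, hI, hJ, hK, map_one]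
    ext i j
    fin_cases i <;> fin_cases j <;> simp <;> field_simp <;> ring
  have hbij : Function.Bijective Φ := by
    refine ⟨?_, hsurj⟩
    have hf : Module.finrank Ω (Ω ⊗[k] ℍ[k, (a : k), (b : k)]) =
        Module.finrank Ω (Matrix (Fin 2) (Fin 2) Ω) := by
      rw [Module.finrank_baseChange, QuaternionAlgebra.finrank_eq_four, Module.finrank_matrix]
      simp
    exact (LinearMap.injective_iff_surjective_of_finrank_eq_finrank
      (f := Φ.toLinearMap) hf).2 hsurj
  exact ⟨AlgEquiv.ofBijective Φ hbij, fun x => (hΦ x).trans (hφ x)⟩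

/-- A quaternion algebra has a Brauer class. -/
theorem exists_hasBrauerClass_quaternion [Algebra.IsAlgebraic k Ω] [IsAlgClosed Ω] [NeZero (2 : k)]
    (a b : kˣ) : ∃ x : Br k Ω, HasBrauerClass k ℍ[k, (a : k), (b : k)] x := by
  classical
  obtain ⟨r, hr⟩ := IsAlgClosed.exists_pow_nat_eq (algebraMap k Ω a) (n := 2) two_pos
  set β : Ω := algebraMap k Ω b with hβ
  have h2 : (2 : Ω) ≠ 0 := by
    have := (map_ne_zero (algebraMap k Ω)).2 (NeZero.ne (2 : k))
    rwa [map_ofNat] at this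
  have hβ0 : β ≠ 0 := (map_ne_zero _).2 b.ne_zero
  have hr0 : r ≠ 0 := by
    rintro rfl
    have : algebraMap k Ω a ≠ 0 := (map_ne_zero _).2 a.ne_zero
    exact this (by rw [← hr]; simp)
  have hrr : -r ≠ r := fun h => by
    have : (2 : Ω) * r = 0 := by linear_combination -h
    rcases mul_eq_zero.1 this with h | h
    exacts [h2 h, hr0 h]
  have hσ (σ : Ω ≃ₐ[k] Ω) : σ r = r ∨ σ r = -r := by
    have : (σ r) ^ 2 = r ^ 2 := by rw [← map_pow, hr, AlgEquiv.commutes]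
    exact sq_eq_sq_iff_eq_or_eq_neg.1 this
  have hστ (σ τ : Ω ≃ₐ[k] Ω) : (σ * τ) r = r ↔ (σ r = r ↔ τ r = r) := by
    rw [AlgEquiv.mul_apply]
    rcases hσ σ with h | h <;> rcases hσ τ with h' | h' <;> simp [h, h', hrr]
  have hσβ (σ : Ω ≃ₐ[k] Ω) : σ β = β := AlgEquiv.commutes σ _
  let J : GL (Fin 2) Ω := Matrix.GeneralLinearGroup.mkOfDetNeZero !![0, β; 1, 0] (by simp [hβ0])
  have hJval : J.val = !![0, β; 1, 0] := rfl
  have hJσ (σ : Ω ≃ₐ[k] Ω) : J.val.map σ = J.val := by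
    rw [hJval]
    ext i j
    fin_cases i <;> fin_cases j <;> simp [hσβ]
  let P : (Ω ≃ₐ[k] Ω) → GL (Fin 2) Ω := fun σ => if σ r = r then 1 else J
  let B : Ωˣ := Units.mk0 β hβ0
  let c : (Ω ≃ₐ[k] Ω) × (Ω ≃ₐ[k] Ω) → Ωˣ := fun p =>
    if p.1 r = r then 1 else if p.2 r = r then 1 else B
  have hlc : IsLocallyConstant (fun σ : Ω ≃ₐ[k] Ω => σ r) := isLocallyConstant_apply r
  have hPl : IsLocallyConstant P := hlc.comp (fun y => if y = r then 1 else J)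
  have hcl : IsLocallyConstant c :=
    ((hlc.comp_continuous continuous_fst).prodMk (hlc.comp_continuous continuous_snd)).comp
      (fun y : Ω × Ω => if y.1 = r then 1 else if y.2 = r then 1 else B)
  have hcB (σ : Ω ≃ₐ[k] Ω) : galUnits k Ω σ B = B := Units.ext (hσβ σ)
  have hc : c ∈ cocycles₂ (galUnits k Ω) := by
    refine ⟨hcl, fun g h l => ?_⟩
    simp only [c, hστ]
    by_cases h1 : g r = r <;> by_cases h2 : h r = r <;> by_cases h3 : l r = r <;>
      simp [h1, h2, h3, hcB]
  obtain ⟨e, he⟩ := exists_quaternion_splitting a b r hr hr0 h2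
  have hconj (σ : Ω ≃ₐ[k] Ω) (x : ℍ[k, (a : k), (b : k)]) : e (1 ⊗ₜ x) = (P σ).val * (e (1 ⊗ₜ x)).map σ * (P σ)⁻¹.val := by
    rw [Units.eq_mul_inv_iff_mul_eq, he]
    rcases hσ σ with h | h
    · have : P σ = 1 := if_pos h
      rw [this]
      ext i j
      fin_cases i <;> fin_cases j <;> simp [h]
    · have : P σ = J := if_neg (by rw [h]; exact hrr)
      rw [this, hJval]
      ext i j
      fin_cases i <;> fin_cases j <;>
        simp [h, Matrix.mul_apply, Fin.sum_univ_two] <;> ring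
  refine ⟨QuotientGroup.mk ⟨c, hc⟩, 2, e, P, ⟨c, hc⟩, two_ne_zero, hPl,
    hconj, fun σ τ => ?_, rfl⟩
  · by_cases h1 : σ r = r <;> by_cases h2 : τ r = r
    · have e1 : P σ = 1 := if_pos h1
      have e2 : P τ = 1 := if_pos h2
      have e3 : P (σ * τ) = 1 := if_pos ((hστ σ τ).2 (by simp [h1, h2]))
      have e4 : c (σ, τ) = 1 := if_pos h1
      simp [e1, e2, e3, e4]
    · have e1 : P σ = 1 := if_pos h1
      have e2 : P τ = J := if_neg h2
      have e3 : P (σ * τ) = J := if_neg (mt (hστ σ τ).1 (by simp [h1, h2]))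
      have e4 : c (σ, τ) = 1 := if_pos h1
      simp [e1, e2, e3, e4, hJσ]
    · have e1 : P σ = J := if_neg h1
      have e2 : P τ = 1 := if_pos h2
      have e3 : P (σ * τ) = J := if_neg (mt (hστ σ τ).1 (by simp [h1, h2]))
      have e4 : c (σ, τ) = 1 := (if_neg h1).trans (if_pos h2)
      simp [e1, e2, e3, e4]
    · have e1 : P σ = J := if_neg h1
      have e2 : P τ = J := if_neg h2
      have e3 : P (σ * τ) = 1 := if_pos ((hστ σ τ).2 (by simp [h1, h2]))
      have e4 : c (σ, τ) = B := (if_neg h1).trans (if_neg h2)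
      simp only [e1, e2, e3, e4, hJval, Units.val_one]
      ext i j
      fin_cases i <;> fin_cases j <;> simp [Matrix.mul_apply, Fin.sum_univ_two, B, hσβ]

/-- The Hilbert symbol `(a, b)_k` in `Br k`: the Brauer class of the quaternion algebra with
`i² = a`, `j² = b`, `i j = - j i`. -/
noncomputable def hilbertSymbol (k Ω : Type*) [Field k] [Field Ω] [Algebra k Ω]
    [Algebra.IsAlgebraic k Ω] [IsAlgClosed Ω] [NeZero (2 : k)] (a b : kˣ) : Br k Ω :=
  (exists_hasBrauerClass_quaternion a b).choose

theorem hasBrauerClass_hilbertSymbol {Ω : Type*} [Field Ω] [Algebra k Ω]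
    [Algebra.IsAlgebraic k Ω] [IsAlgClosed Ω] [NeZero (2 : k)] (a b : kˣ) :
    HasBrauerClass k ℍ[k, (a : k), (b : k)] (hilbertSymbol k Ω a b) :=
  (exists_hasBrauerClass_quaternion a b).choose_spec

end Brauer

section AV
open CategoryTheory MonoidalCategory CartesianMonoidalCategory AlgebraicGeometry Limits MonObj
/-- Endomorphisms of a group object. -/
structure GroupEnd {C : Type u} [Category.{v} C] [CartesianMonoidalCategory C]
    (G : C) [GrpObj G] where
  hom : G ⟶ G
  isMonHom : IsMonHom hom

namespace GroupEnd
variable {C : Type u} [Category.{v} C] [CartesianMonoidalCategory C]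

@[ext] theorem ext' {G : C} [GrpObj G] {f g : GroupEnd G} (h : f.hom = g.hom) : f = g := by
  cases f; cases g; cases h; rfl

instance {G : C} [GrpObj G] (f : GroupEnd G) : IsMonHom f.hom := f.isMonHom

theorem isMonHom_of_mul {G : C} [GrpObj G] {f : G ⟶ G} (h : μ[G] ≫ f = (f ⊗ₘ f) ≫ μ[G]) :
    IsMonHom f where
  mul_hom := h
  one_hom := by
    have h1 : (η[G] ≫ f) * (η[G] ≫ f) = η[G] ≫ f := by
      have : lift η[G] η[G] ≫ μ[G] = η[G] := by
        change η[G] * η[G] = η[G]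
        rw [MonObj.one_eq_one, _root_.mul_one]
      calc (η[G] ≫ f) * (η[G] ≫ f) = lift η[G] η[G] ≫ (f ⊗ₘ f) ≫ μ[G] := by
            rw [← Category.assoc, lift_map]; rfl
        _ = _ := by rw [← h, ← Category.assoc, this]
    have := mul_eq_left.mp h1
    rw [this, MonObj.one_eq_one]

instance (G : C) [GrpObj G] : One (GroupEnd G) := ⟨⟨𝟙 G, inferInstance⟩⟩

instance (G : C) [GrpObj G] : Mul (GroupEnd G) := ⟨fun f g => ⟨g.hom ≫ f.hom, inferInstance⟩⟩

instance (G : C) [GrpObj G] : Zero (GroupEnd G) :=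
  ⟨⟨1, inferInstanceAs (IsMonHom (toUnit G ≫ η[G]))⟩⟩

variable [BraidedCategory C]

instance (G : C) [GrpObj G] [IsCommMonObj G] : Add (GroupEnd G) :=
  ⟨fun f g => ⟨f.hom * g.hom, inferInstanceAs (IsMonHom (lift f.hom g.hom ≫ μ[G]))⟩⟩

instance (G : C) [GrpObj G] [IsCommMonObj G] : Neg (GroupEnd G) :=
  ⟨fun f => ⟨f.hom⁻¹, inferInstance⟩⟩

instance (G : C) [GrpObj G] [IsCommMonObj G] : Ring (GroupEnd G) where
  add_assoc f g h := ext' (mul_assoc f.hom g.hom h.hom)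
  zero_add f := ext' (one_mul f.hom)
  add_zero f := ext' (mul_one f.hom)
  add_comm f g := ext' (mul_comm f.hom g.hom)
  neg_add_cancel f := ext' (inv_mul_cancel f.hom)
  mul_assoc f g h := ext' (Category.assoc h.hom g.hom f.hom).symm
  one_mul f := ext' (Category.comp_id f.hom)
  mul_one f := ext' (Category.id_comp f.hom)
  zero_mul f := ext' (MonObj.comp_one f.hom)
  mul_zero f := ext' (MonObj.one_comp f.hom)
  left_distrib f g h := ext' (MonObj.mul_comp g.hom h.hom f.hom)
  right_distrib f g h := ext' (MonObj.comp_mul h.hom f.hom g.hom)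
  nsmul := nsmulRec
  zsmul := zsmulRec

end GroupEnd

/-- An abelian variety over a field `K`: a proper, geometrically integral group scheme over `K`. -/
structure AbelianVariety (K : Type u) [Field K] where
  X : Over (Spec (.of K))
  [grpObj : GrpObj X]
  [isProper : IsProper X.hom]
  [geometricallyIntegral : GeometricallyIntegral X.hom]

namespace AbelianVariety
variable {K : Type u} [Field K]
attribute [instance] grpObj isProper geometricallyIntegral

instance (A : AbelianVariety K) : IsCommMonObj A.X :=
  isCommMonObj_of_isProper_of_geometricallyIntegral A.X

/-- The base change of `A` to an extension `L` of `K`. -/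
noncomputable def baseChange (A : AbelianVariety K) (L : Type u) [Field L] [Algebra K L] :
    AbelianVariety L where
  X := (Over.pullback (Spec.map (CommRingCat.ofHom (algebraMap K L)))).obj A.X
  grpObj := Functor.grpObjObj
  isProper := by dsimp; infer_instance
  geometricallyIntegral := by dsimp; infer_instance

/-- The endomorphism ring; multiplication is composition. -/
abbrev EndRing (A : AbelianVariety K) : Type u := GroupEnd A.X


/-- Base change of endomorphisms, `End_K(A) → End_L(A_L)`. -/
noncomputable def endBaseChange (A : AbelianVariety K) (L : Type u) [Field L] [Algebra K L] :
    A.EndRing →+* (A.baseChange L).EndRing :=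
  let F := Over.pullback (Spec.map (CommRingCat.ofHom (algebraMap K L)))
  letI : GrpObj (F.obj A.X) := Functor.grpObjObj
  { toFun f := ⟨F.map f.hom, (inferInstance : IsMonHom (F.map f.hom))⟩
    map_one' := GroupEnd.ext' (F.map_id _)
    map_mul' f g := GroupEnd.ext' (F.map_comp g.hom f.hom)
    map_zero' := GroupEnd.ext' (CategoryTheory.Functor.map_one F)
    map_add' f g := GroupEnd.ext' (CategoryTheory.Functor.map_mul F f.hom g.hom) }

section Galois
variable (A : AbelianVariety K) {L : Type u} [Field L] [Algebra K L]

variable (L) in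
/-- The projection `A_L → A`. -/
noncomputable def proj : (A.baseChange L).X.left ⟶ A.X.left := pullback.fst _ _

theorem hom_ext_baseChange {Y : Scheme.{u}} {f g : Y ⟶ (A.baseChange L).X.left}
    (h₁ : f ≫ A.proj L = g ≫ A.proj L)
    (h₂ : f ≫ (A.baseChange L).X.hom = g ≫ (A.baseChange L).X.hom) : f = g :=
  pullback.hom_ext h₁ h₂

/-- The automorphism `id × Spec σ` of the `K`-scheme `A_L = A ×_K Spec L`. -/
noncomputable def twist (σ : L ≃ₐ[K] L) :
    (A.baseChange L).X.left ⟶ (A.baseChange L).X.left :=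
  pullback.map _ _ _ _ (𝟙 _) (Spec.map (CommRingCat.ofHom (σ : L →+* L))) (𝟙 _) (by simp)
    (by rw [← Spec.map_comp, ← CommRingCat.ofHom_comp, Category.comp_id]; congr 2; ext; simp)

theorem twist_proj (σ : L ≃ₐ[K] L) : A.twist σ ≫ A.proj L = A.proj L :=
  (pullback.lift_fst _ _ _).trans (Category.comp_id _)

theorem twist_hom (σ : L ≃ₐ[K] L) : A.twist σ ≫ (A.baseChange L).X.hom =
    (A.baseChange L).X.hom ≫ Spec.map (CommRingCat.ofHom (σ : L →+* L)) :=
  pullback.lift_snd _ _ _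

theorem twist_mul (σ τ : L ≃ₐ[K] L) : A.twist (σ * τ) = A.twist σ ≫ A.twist τ := by
  apply A.hom_ext_baseChange
  · simp only [Category.assoc, twist_proj]
  · simp only [Category.assoc, twist_hom]
    rw [← Category.assoc, twist_hom, Category.assoc, ← Spec.map_comp, ← CommRingCat.ofHom_comp]
    rfl

theorem twist_one : A.twist (1 : L ≃ₐ[K] L) = 𝟙 _ := by
  apply A.hom_ext_baseChange
  · simp only [twist_proj, Category.id_comp]
  · rw [twist_hom, Category.id_comp]
    exact (congrArg _ (Spec.map_id _)).trans (Category.comp_id _)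

theorem twist_inv_comp (σ : L ≃ₐ[K] L) : A.twist σ⁻¹ ≫ A.twist σ = 𝟙 _ := by
  rw [← twist_mul, inv_mul_cancel, twist_one]

theorem twist_comp_inv (σ : L ≃ₐ[K] L) : A.twist σ ≫ A.twist σ⁻¹ = 𝟙 _ := by
  rw [← twist_mul, mul_inv_cancel, twist_one]


variable (L) in
/-- The projection `A_L × A_L → A × A`. -/
noncomputable def proj₂ : ((A.baseChange L).X ⊗ (A.baseChange L).X).left ⟶ (A.X ⊗ A.X).left :=
  pullback.map _ _ _ _ (A.proj L) (A.proj L) (Spec.map (CommRingCat.ofHom (algebraMap K L)))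
      pullback.condition.symm pullback.condition.symm

theorem mul_left_proj : μ[(A.baseChange L).X].left ≫ A.proj L = A.proj₂ L ≫ μ[A.X].left := by
  let F := Over.pullback (Spec.map (CommRingCat.ofHom (algebraMap K L)))
  change (Functor.LaxMonoidal.μ F A.X A.X ≫ F.map μ[A.X]).left ≫ pullback.fst _ _ = _
  rw [Over.comp_left, Category.assoc]
  have : (F.map μ[A.X]).left ≫ pullback.fst _ _ = pullback.fst _ _ ≫ μ[A.X].left :=
    pullback.lift_fst _ _ _
  rw [this, ← Category.assoc]
  congr 1
  apply pullback.hom_ext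
  · rw [Category.assoc]
    exact (Over.μ_pullback_left_fst_fst A.X A.X).trans (pullback.lift_fst _ _ _).symm
  · rw [Category.assoc]
    exact (Over.μ_pullback_left_fst_snd A.X A.X).trans (pullback.lift_snd _ _ _).symm

/-- The automorphism of `A_L × A_L` given by `twist` on both factors. -/
noncomputable def twist₂ (σ : L ≃ₐ[K] L) :
    ((A.baseChange L).X ⊗ (A.baseChange L).X).left ⟶
      ((A.baseChange L).X ⊗ (A.baseChange L).X).left :=
  pullback.map _ _ _ _ (A.twist σ) (A.twist σ) (Spec.map (CommRingCat.ofHom (σ : L →+* L)))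
    (A.twist_hom σ).symm (A.twist_hom σ).symm

theorem twist₂_fst (σ : L ≃ₐ[K] L) :
    A.twist₂ σ ≫ pullback.fst _ _ = pullback.fst _ _ ≫ A.twist σ := pullback.lift_fst _ _ _

theorem twist₂_snd (σ : L ≃ₐ[K] L) :
    A.twist₂ σ ≫ pullback.snd _ _ = pullback.snd _ _ ≫ A.twist σ := pullback.lift_snd _ _ _

theorem twist₂_proj₂ (σ : L ≃ₐ[K] L) : A.twist₂ σ ≫ A.proj₂ L = A.proj₂ L := by
  have h1 : A.proj₂ L ≫ pullback.fst _ _ = pullback.fst _ _ ≫ A.proj L := pullback.lift_fst _ _ _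
  have h2 : A.proj₂ L ≫ pullback.snd _ _ = pullback.snd _ _ ≫ A.proj L := pullback.lift_snd _ _ _
  apply pullback.hom_ext
  · rw [Category.assoc, h1, ← Category.assoc, twist₂_fst, Category.assoc, twist_proj]
  · rw [Category.assoc, h2, ← Category.assoc, twist₂_snd, Category.assoc, twist_proj]

theorem mul_left_twist (σ : L ≃ₐ[K] L) :
    μ[(A.baseChange L).X].left ≫ A.twist σ = A.twist₂ σ ≫ μ[(A.baseChange L).X].left := by
  apply A.hom_ext_baseChange
  · rw [Category.assoc, twist_proj, Category.assoc, mul_left_proj, ← Category.assoc, twist₂_proj₂]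
  · rw [Category.assoc, twist_hom, Category.assoc, Over.w, ← Category.assoc, Over.w,
      Over.tensorObj_hom, ← Category.assoc, twist₂_fst, Category.assoc, Category.assoc, twist_hom]

theorem spec_inv_comp (σ : L ≃ₐ[K] L) :
    Spec.map (CommRingCat.ofHom (σ : L →+* L)) ≫
      Spec.map (CommRingCat.ofHom ((σ⁻¹ : L ≃ₐ[K] L) : L →+* L)) = 𝟙 _ := by
  rw [← Spec.map_comp, ← CommRingCat.ofHom_comp]
  have : (σ : L →+* L).comp ((σ⁻¹ : L ≃ₐ[K] L) : L →+* L) = RingHom.id L := by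
    ext x; exact σ.apply_symm_apply x
  rw [this]
  exact Spec.map_id _

/-- The conjugate of `f` by `σ`. On points it is `x ↦ σ(f(σ⁻¹ x))`: a point `x : Spec L → A`
gives the section `(x, id)` of `A_L`, and `(σ x, id)` is `Spec σ` followed by `(x, id)` followed by
the inverse of `id × Spec σ`. -/
noncomputable def galConjHom (σ : L ≃ₐ[K] L) (f : (A.baseChange L).X ⟶ (A.baseChange L).X) :
    (A.baseChange L).X ⟶ (A.baseChange L).X :=
  Over.homMk (A.twist σ ≫ f.left ≫ A.twist σ⁻¹) (by
    rw [Category.assoc, Category.assoc, twist_hom, ← Category.assoc f.left, Over.w,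
      ← Category.assoc, twist_hom, Category.assoc, spec_inv_comp, Category.comp_id])

theorem isMonHom_galConjHom (σ : L ≃ₐ[K] L) (f : (A.baseChange L).X ⟶ (A.baseChange L).X)
    [IsMonHom f] : IsMonHom (A.galConjHom σ f) := by
  apply GroupEnd.isMonHom_of_mul
  apply Over.OverMorphism.ext
  have hf : μ[(A.baseChange L).X].left ≫ f.left = (f ⊗ₘ f).left ≫ μ[(A.baseChange L).X].left := by
    rw [← Over.comp_left, IsMonHom.mul_hom, Over.comp_left]
  have ht : A.twist₂ σ ≫ (f ⊗ₘ f).left ≫ A.twist₂ σ⁻¹ =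
      (A.galConjHom σ f ⊗ₘ A.galConjHom σ f).left := by
    have h1 (g : (A.baseChange L).X ⟶ (A.baseChange L).X) :
      (g ⊗ₘ g).left ≫ pullback.fst _ _ = pullback.fst _ _ ≫ g.left :=
        congrArg (fun h => h.left) (tensorHom_fst g g)
    have h2 (g : (A.baseChange L).X ⟶ (A.baseChange L).X) :
      (g ⊗ₘ g).left ≫ pullback.snd _ _ = pullback.snd _ _ ≫ g.left :=
        congrArg (fun h => h.left) (tensorHom_snd g g)
    apply pullback.hom_ext
    · rw [h1, Category.assoc, Category.assoc, twist₂_fst, ← Category.assoc (f ⊗ₘ f).left, h1,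
        Category.assoc, ← Category.assoc, twist₂_fst, Category.assoc]
      rfl
    · rw [h2, Category.assoc, Category.assoc, twist₂_snd, ← Category.assoc (f ⊗ₘ f).left, h2,
        Category.assoc, ← Category.assoc, twist₂_snd, Category.assoc]
      rfl
  rw [Over.comp_left, Over.comp_left, ← ht]
  change _ ≫ A.twist σ ≫ f.left ≫ A.twist σ⁻¹ = _
  rw [← Category.assoc, mul_left_twist, Category.assoc, ← Category.assoc _ f.left, hf,
    Category.assoc, mul_left_twist, Category.assoc, Category.assoc]

/-- The action of `σ ∈ Gal(L/K)` on `End_L(A_L)`, `σ(f)(x) = σ(f(σ⁻¹ x))`. -/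
noncomputable def galConj (σ : L ≃ₐ[K] L) (f : (A.baseChange L).EndRing) :
    (A.baseChange L).EndRing :=
  ⟨A.galConjHom σ f.hom, A.isMonHom_galConjHom σ f.hom⟩

theorem galConj_mul (σ τ : L ≃ₐ[K] L) (f : (A.baseChange L).EndRing) :
    A.galConj (σ * τ) f = A.galConj σ (A.galConj τ f) := by
  apply GroupEnd.ext'
  apply Over.OverMorphism.ext
  change A.twist (σ * τ) ≫ f.hom.left ≫ A.twist (σ * τ)⁻¹ =
    A.twist σ ≫ (A.twist τ ≫ f.hom.left ≫ A.twist τ⁻¹) ≫ A.twist σ⁻¹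
  rw [mul_inv_rev, twist_mul, twist_mul]
  simp only [Category.assoc]

theorem galConj_one (f : (A.baseChange L).EndRing) :
    A.galConj (1 : L ≃ₐ[K] L) f = f := by
  apply GroupEnd.ext'
  apply Over.OverMorphism.ext
  change A.twist 1 ≫ f.hom.left ≫ A.twist 1⁻¹ = f.hom.left
  rw [inv_one, twist_one, Category.id_comp, Category.comp_id]

end Galois
end AbelianVariety
end AV

section Alpha
open scoped TensorProduct
open GalCoh

theorem continuous_restrictScalarsHom {K Ω : Type*} [Field K] [Field Ω] [Algebra K Ω]
    [Algebra.IsAlgebraic K Ω] (M : IntermediateField K Ω) :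
    Continuous (AlgEquiv.restrictScalarsHom K : (Ω ≃ₐ[M] Ω) →* (Ω ≃ₐ[K] Ω)) := by
  apply continuous_of_continuousAt_one
  rw [ContinuousAt, map_one]
  intro U hU
  obtain ⟨E, hE, hEU⟩ := (krullTopology_mem_nhds_one_iff K Ω U).1 hU
  let b := Module.finBasis K E
  have hev : ∀ᶠ σ : Ω ≃ₐ[M] Ω in nhds 1, ∀ i, σ (b i : Ω) = b i :=
    Filter.eventually_all.2 fun i => (isLocallyConstant_apply (b i : Ω)).eventually_eq 1
  refine Filter.mem_map.2 <| Filter.mem_of_superset hev fun σ hσ => hEU ?_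
  change (AlgEquiv.restrictScalarsHom K σ : Ω ≃ₐ[K] Ω) ∈ E.fixingSubgroup
  rw [IntermediateField.mem_fixingSubgroup_iff]
  intro x hx
  have h : ((AlgEquiv.restrictScalarsHom K σ : Ω ≃ₐ[K] Ω).toLinearMap ∘ₗ E.val.toLinearMap) =
      E.val.toLinearMap := b.ext fun i => hσ i
  exact DFunLike.congr_fun h ⟨x, hx⟩

namespace AbelianVariety
variable {K : Type u} [Field K]

/-- The endomorphism algebra `End(A) ⊗ ℚ`. -/
abbrev EndAlg (A : AbelianVariety K) : Type u := ℚ ⊗[ℤ] A.EndRing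

variable (A : AbelianVariety K) (Ω : Type u) [Field Ω] [Algebra K Ω]

/-- `X = End_Ω(A) ⊗ ℚ`. -/
abbrev geomEndAlg : Type u := (A.baseChange Ω).EndAlg

/-- `E = End_K(A) ⊗ ℚ`, as a subalgebra of `X = End_Ω(A) ⊗ ℚ`. -/
noncomputable def rationalEndAlg : Subalgebra ℚ (A.geomEndAlg Ω) :=
  (Algebra.TensorProduct.map (AlgHom.id ℚ ℚ) (A.endBaseChange Ω).toIntAlgHom).range

/-- `F`, the centre of `X`. -/
noncomputable abbrev centerField : Subalgebra ℚ (A.geomEndAlg Ω) :=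
  Subalgebra.center ℚ (A.geomEndAlg Ω)

/-- `A` is a Ribet-Pyle abelian variety: `E = End_K(A) ⊗ ℚ` is a maximal subfield (a subfield that
is its own centralizer) of the simple algebra `X = End_Ω(A) ⊗ ℚ`. -/
structure IsRibetPyle : Prop where
  isSimpleRing : IsSimpleRing (A.geomEndAlg Ω)
  isField : IsField (A.rationalEndAlg Ω)
  centralizer_eq : Subalgebra.centralizer ℚ (A.rationalEndAlg Ω : Set (A.geomEndAlg Ω)) =
    A.rationalEndAlg Ω

variable {A Ω}

theorem IsRibetPyle.centerField_le (h : A.IsRibetPyle Ω) :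
    A.centerField Ω ≤ A.rationalEndAlg Ω :=
  (Subalgebra.center_le_centralizer ℚ _).trans h.centralizer_eq.le

/-- The embedding of `F` in `Ω` obtained by restriction of an embedding `j` of `E` in `Ω`. -/
noncomputable def IsRibetPyle.centerEmb (h : A.IsRibetPyle Ω) (j : A.rationalEndAlg Ω →+* Ω) :
    A.centerField Ω →+* Ω :=
  j.comp (Subalgebra.inclusion h.centerField_le).toRingHom

/-- The compositum `FK` inside `Ω`. -/
noncomputable def IsRibetPyle.compositum (h : A.IsRibetPyle Ω) (j : A.rationalEndAlg Ω →+* Ω) :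
    IntermediateField K Ω :=
  IntermediateField.adjoin K (Set.range (h.centerEmb j))

/-- The inclusion of `F` in `FK`. -/
noncomputable def IsRibetPyle.centerToCompositum (h : A.IsRibetPyle Ω)
    (j : A.rationalEndAlg Ω →+* Ω) : A.centerField Ω →+* h.compositum j :=
  (h.centerEmb j).codRestrict (h.compositum j) fun x =>
    IntermediateField.subset_adjoin K _ ⟨x, rfl⟩

/-- A (locally constant) choice `σ ↦ α(σ)` of elements of `Xˣ` such that `σ ∈ Gal(Ω/K)` acts on
`End_Ω(A)`, hence on `X`, as conjugation by `α(σ)`. -/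
structure IsConjugator (α : (Ω ≃ₐ[K] Ω) → (A.geomEndAlg Ω)ˣ) : Prop where
  isLocallyConstant : IsLocallyConstant α
  conj : ∀ (σ : Ω ≃ₐ[K] Ω) (f : (A.baseChange Ω).EndRing),
    (α σ).val * ((1 : ℚ) ⊗ₜ[ℤ] f) * (α σ)⁻¹.val = (1 : ℚ) ⊗ₜ[ℤ] A.galConj σ f

namespace IsConjugator
variable {α : (Ω ≃ₐ[K] Ω) → (A.geomEndAlg Ω)ˣ}

theorem mul_tmul (h : IsConjugator α) (σ : Ω ≃ₐ[K] Ω) (f : (A.baseChange Ω).EndRing) :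
    (α σ).val * ((1 : ℚ) ⊗ₜ[ℤ] f) = ((1 : ℚ) ⊗ₜ[ℤ] A.galConj σ f) * (α σ).val := by
  rw [← h.conj, mul_assoc _ _ (α σ).val, Units.inv_mul, mul_one]

theorem inv_mul_tmul (h : IsConjugator α) (σ : Ω ≃ₐ[K] Ω) (f : (A.baseChange Ω).EndRing) :
    (α σ)⁻¹.val * ((1 : ℚ) ⊗ₜ[ℤ] f) = ((1 : ℚ) ⊗ₜ[ℤ] A.galConj σ⁻¹ f) * (α σ)⁻¹.val := by
  rw [Units.eq_mul_inv_iff_mul_eq, mul_assoc, Units.inv_mul_eq_iff_eq_mul, h.mul_tmul,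
    ← galConj_mul, mul_inv_cancel, galConj_one]

theorem mem_center_of_commute {u : A.geomEndAlg Ω}
    (hu : ∀ f : (A.baseChange Ω).EndRing, u * ((1 : ℚ) ⊗ₜ[ℤ] f) = ((1 : ℚ) ⊗ₜ[ℤ] f) * u) :
    u ∈ A.centerField Ω := by
  rw [Subalgebra.mem_center_iff]
  intro z
  induction z using TensorProduct.induction_on with
  | zero => rw [zero_mul, mul_zero]
  | add x y hx hy => rw [add_mul, mul_add, hx, hy]
  | tmul q f =>
    have : q ⊗ₜ[ℤ] f = q • ((1 : ℚ) ⊗ₜ[ℤ] f) := by simp [TensorProduct.smul_tmul']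
    rw [this, smul_mul_assoc, mul_smul_comm, hu]

theorem mul_mem_center (h : IsConjugator α) (σ τ : Ω ≃ₐ[K] Ω) :
    (α σ * α τ * (α (σ * τ))⁻¹).val ∈ A.centerField Ω := by
  apply mem_center_of_commute
  intro f
  rw [Units.val_mul, Units.val_mul, mul_assoc, h.inv_mul_tmul, mul_assoc, ← mul_assoc (α τ).val,
    h.mul_tmul, mul_assoc _ (α τ).val, ← mul_assoc (α σ).val, h.mul_tmul, mul_assoc,
    ← galConj_mul, ← galConj_mul, ← mul_assoc, mul_inv_cancel, galConj_one]
  simp only [mul_assoc]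

/-- `c_α(σ, τ) = α(σ) α(τ) α(σ τ)⁻¹`, as an element of `Fˣ`. -/
noncomputable def cocycleFun (h : IsConjugator α) (p : (Ω ≃ₐ[K] Ω) × (Ω ≃ₐ[K] Ω)) :
    (A.centerField Ω)ˣ where
  val := ⟨(α p.1 * α p.2 * (α (p.1 * p.2))⁻¹).val, h.mul_mem_center p.1 p.2⟩
  inv := ⟨(α p.1 * α p.2 * (α (p.1 * p.2))⁻¹)⁻¹.val, by
    apply mem_center_of_commute
    intro f
    have := Subalgebra.mem_center_iff.1 (h.mul_mem_center p.1 p.2) (1 ⊗ₜ f)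
    rw [Units.inv_mul_eq_iff_eq_mul, ← mul_assoc, Units.eq_mul_inv_iff_mul_eq]
    exact this⟩
  val_inv := Subtype.ext (Units.mul_inv (α p.1 * α p.2 * (α (p.1 * p.2))⁻¹))
  inv_val := Subtype.ext (Units.inv_mul (α p.1 * α p.2 * (α (p.1 * p.2))⁻¹))

theorem cocycleFun_injective : Function.Injective
    (Units.map (A.centerField Ω).val.toRingHom.toMonoidHom) :=
  fun _ _ h => Units.ext (Subtype.ext (congrArg Units.val h))

/-- The 2-cocycle `c_α` with values in `Fˣ` with trivial Galois action. -/
noncomputable def cocycle (h : IsConjugator α) :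
    cocycles₂ (1 : (Ω ≃ₐ[K] Ω) →* MulAut (A.centerField Ω)ˣ) :=
  ⟨h.cocycleFun, by
    have hu (σ τ : Ω ≃ₐ[K] Ω) : Units.map (A.centerField Ω).val.toRingHom.toMonoidHom
        (h.cocycleFun (σ, τ)) = α σ * α τ * (α (σ * τ))⁻¹ := Units.ext rfl
    refine ⟨?_, fun g k l => ?_⟩
    · have h1 := h.isLocallyConstant
      have h2 : IsLocallyConstant (fun p : (Ω ≃ₐ[K] Ω) × (Ω ≃ₐ[K] Ω) =>
          α p.1 * α p.2 * (α (p.1 * p.2))⁻¹) :=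
        ((h1.comp_continuous continuous_fst).mul (h1.comp_continuous continuous_snd)).mul
          (h1.comp_continuous continuous_mul).inv
      rw [IsLocallyConstant.iff_eventually_eq] at h2 ⊢
      intro p
      filter_upwards [h2 p] with q hq
      exact cocycleFun_injective hq
    · apply cocycleFun_injective
      have hc : α g * (α k * α l * (α (k * l))⁻¹) = (α k * α l * (α (k * l))⁻¹) * α g :=
        Units.ext (Subalgebra.mem_center_iff.1 (h.mul_mem_center k l) _)
      change Units.map _ (h.cocycleFun (g * k, l) * h.cocycleFun (g, k)) =
        Units.map _ (h.cocycleFun (k, l) * h.cocycleFun (g, k * l))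
      rw [mul_comm (h.cocycleFun (g * k, l)), map_mul, map_mul, hu, hu, hu, hu,
        ← mul_assoc (α k * α l * _), ← mul_assoc (α k * α l * _), ← hc]
      simp only [mul_assoc, inv_mul_cancel_left]⟩

end IsConjugator

/-- The map `ι_* : H²(G_{FK}, Fˣ) → H²(G_{FK}, Ωˣ) = Br(FK)` given by `Fˣ ⊆ Ωˣ`. -/
noncomputable def IsRibetPyle.iotaStar [Algebra.IsAlgebraic K Ω] (h : A.IsRibetPyle Ω)
    (j : A.rationalEndAlg Ω →+* Ω) :
    H2 (1 : (Ω ≃ₐ[h.compositum j] Ω) →* MulAut (A.centerField Ω)ˣ) →* Br (h.compositum j) Ω :=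
  H2.map (MonoidHom.id _) continuous_id (Units.map (h.centerEmb j)) fun σ m => by
    apply Units.ext
    exact (σ.commutes (h.centerToCompositum j m)).symm

/-- The restriction `H²(G_K, Fˣ) → H²(G_{FK}, Fˣ)`. -/
noncomputable def IsRibetPyle.res [Algebra.IsAlgebraic K Ω] (h : A.IsRibetPyle Ω)
    (j : A.rationalEndAlg Ω →+* Ω) :
    H2 (1 : (Ω ≃ₐ[K] Ω) →* MulAut (A.centerField Ω)ˣ) →*
      H2 (1 : (Ω ≃ₐ[h.compositum j] Ω) →* MulAut (A.centerField Ω)ˣ) :=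
  H2.map (AlgEquiv.restrictScalarsHom K) (continuous_restrictScalarsHom _) (MonoidHom.id _)
    fun _ _ => rfl

/-- The kernel of `σ ↦ α(σ)²` modulo `(Fˣ)²`. -/
def kerSq (α : (Ω ≃ₐ[K] Ω) → (A.geomEndAlg Ω)ˣ) : Set (Ω ≃ₐ[K] Ω) :=
  {σ | ∃ y : (A.centerField Ω)ˣ, (α σ).val ^ 2 = (y.val : A.geomEndAlg Ω) ^ 2}

end AbelianVariety
end Alpha

/-! ### Explicit cocycles for quaternion algebras. -/

section Brauer
open scoped TensorProduct Quaternion Classical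
open GalCoh

variable {k : Type*} {Ω : Type*} [Field k] [Field Ω] [Algebra k Ω]

/-! Conjugation by `α σ` is the Galois action, which fixes endomorphisms defined over K. Hence `α σ`
centralizes E, and so lies in E, since E is its own centralizer (`mem_rationalEndAlg`). Because
`c_α` is central, α induces a homomorphism from G_K to Eˣ/Fˣ. If `α(σ)² = y²` with y in Fˣ, then `α
σ = ±y` in the field E, so this homomorphism is trivial on G_N and factors through Gal(N/K), an
elementary abelian 2-group with the `σ i` dual to the characters of the `√tᵢ`. Therefore, modulo Fˣ,
`α(g)` is the product of the `wᵢ(g)`, where `wᵢ(g)` is `α(σᵢ)` if g moves `√tᵢ` and 1 otherwise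
(`MonoidHom.eq_prod_of_dual_family`).

Embed everything in Ωˣ and restrict to G_{FK}. The quotient of `∏ wᵢ` by α takes values in (FK)ˣ,
where G_{FK} acts trivially, so its coboundary is exactly the discrepancy between `c_α` and the
product of the cocycles `wᵢ(g) wᵢ(h) / wᵢ(gh)`. The latter is `α(σᵢ)²` when g and h both move `√tᵢ`
and 1 otherwise, which is the standard cocycle of the quaternion algebra `(tᵢ, α(σᵢ)²)`
(`exists_cocycle_hilbertSymbol`). The comparison is carried out in `mk_eq_prod_hilbertSymbol`, for
an arbitrary function u in place of α. -/

/-- The Hilbert symbol `(a, b)` is represented by the cocycle which is `b` at `(g, h)` if both `g`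
and `h` move a square root `r` of `a`, and `1` otherwise. -/
theorem exists_cocycle_hilbertSymbol [Algebra.IsAlgebraic k Ω] [IsAlgClosed Ω] [NeZero (2 : k)]
    (a b : kˣ) (r : Ω) (hr : r ^ 2 = algebraMap k Ω a) :
    ∃ c : cocycles₂ (galUnits k Ω),
      (∀ g h, c.1 (g, h) = if g r = r then 1 else if h r = r then 1 else
        Units.map (algebraMap k Ω) b) ∧
      hilbertSymbol k Ω a b = QuotientGroup.mk c := by
  set β : Ω := algebraMap k Ω b with hβ
  have h2 : (2 : Ω) ≠ 0 := by
    have := (map_ne_zero (algebraMap k Ω)).2 (NeZero.ne (2 : k))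
    rwa [map_ofNat] at this
  have hβ0 : β ≠ 0 := (map_ne_zero _).2 b.ne_zero
  have hr0 : r ≠ 0 := by
    rintro rfl
    have : algebraMap k Ω a ≠ 0 := (map_ne_zero _).2 a.ne_zero
    exact this (by rw [← hr]; simp)
  have hrr : -r ≠ r := fun h => by
    have : (2 : Ω) * r = 0 := by linear_combination -h
    rcases mul_eq_zero.1 this with h | h
    exacts [h2 h, hr0 h]
  have hσ (σ : Ω ≃ₐ[k] Ω) : σ r = r ∨ σ r = -r := by
    have : (σ r) ^ 2 = r ^ 2 := by rw [← map_pow, hr, AlgEquiv.commutes]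
    exact sq_eq_sq_iff_eq_or_eq_neg.1 this
  have hστ (σ τ : Ω ≃ₐ[k] Ω) : (σ * τ) r = r ↔ (σ r = r ↔ τ r = r) := by
    rw [AlgEquiv.mul_apply]
    rcases hσ σ with h | h <;> rcases hσ τ with h' | h' <;> simp [h, h', hrr]
  have hσβ (σ : Ω ≃ₐ[k] Ω) : σ β = β := AlgEquiv.commutes σ _
  -- J is the image of the quaternion j under the splitting. Its entries are Galois-fixed, and
  -- conjugation by it negates the images of i and k, which is the effect of r ↦ -r. So `P` is 1 or
  -- J according to whether σ fixes r, and `J² = β` produces the value b of the cocycle.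
  let J : GL (Fin 2) Ω := Matrix.GeneralLinearGroup.mkOfDetNeZero !![0, β; 1, 0] (by simp [hβ0])
  have hJval : J.val = !![0, β; 1, 0] := rfl
  have hJσ (σ : Ω ≃ₐ[k] Ω) : J.val.map σ = J.val := by
    rw [hJval]
    ext i j
    fin_cases i <;> fin_cases j <;> simp [hσβ]
  let P : (Ω ≃ₐ[k] Ω) → GL (Fin 2) Ω := fun σ => if σ r = r then 1 else J
  let B : Ωˣ := Units.mk0 β hβ0
  let c : (Ω ≃ₐ[k] Ω) × (Ω ≃ₐ[k] Ω) → Ωˣ := fun p =>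
    if p.1 r = r then 1 else if p.2 r = r then 1 else B
  have hlc : IsLocallyConstant (fun σ : Ω ≃ₐ[k] Ω => σ r) := isLocallyConstant_apply r
  have hPl : IsLocallyConstant P := hlc.comp (fun y => if y = r then 1 else J)
  have hcl : IsLocallyConstant c :=
    ((hlc.comp_continuous continuous_fst).prodMk (hlc.comp_continuous continuous_snd)).comp
      (fun y : Ω × Ω => if y.1 = r then 1 else if y.2 = r then 1 else B)
  have hcB (σ : Ω ≃ₐ[k] Ω) : galUnits k Ω σ B = B := Units.ext (hσβ σ)
  have hc : c ∈ cocycles₂ (galUnits k Ω) := by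
    refine ⟨hcl, fun g h l => ?_⟩
    simp only [c, hστ]
    by_cases h1 : g r = r <;> by_cases h2 : h r = r <;> by_cases h3 : l r = r <;>
      simp [h1, h2, h3, hcB]
  obtain ⟨e, he⟩ := exists_quaternion_splitting a b r hr hr0 h2
  have hconj (σ : Ω ≃ₐ[k] Ω) (x : ℍ[k, (a : k), (b : k)]) : e (1 ⊗ₜ x) = (P σ).val * (e (1 ⊗ₜ x)).map σ * (P σ)⁻¹.val := by
    rw [Units.eq_mul_inv_iff_mul_eq, he]
    rcases hσ σ with h | h
    · have : P σ = 1 := if_pos h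
      rw [this]
      ext i j
      fin_cases i <;> fin_cases j <;> simp [h]
    · have : P σ = J := if_neg (by rw [h]; exact hrr)
      rw [this, hJval]
      ext i j
      fin_cases i <;> fin_cases j <;>
        simp [h, Matrix.mul_apply, Fin.sum_univ_two] <;> ring
  have hB : B = Units.map (algebraMap k Ω) b := Units.ext rfl
  -- `hilbertSymbol` is only a chosen class of the algebra; uniqueness of the Brauer class
  -- identifies it with this explicit one.
  refine ⟨⟨c, hc⟩, fun g h => by rw [← hB], (hasBrauerClass_hilbertSymbol a b).unique
    ⟨2, e, P, ⟨c, hc⟩, two_ne_zero, hPl, hconj, fun σ τ => ?_, rfl⟩⟩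
  · by_cases h1 : σ r = r <;> by_cases h2 : τ r = r
    · have e1 : P σ = 1 := if_pos h1
      have e2 : P τ = 1 := if_pos h2
      have e3 : P (σ * τ) = 1 := if_pos ((hστ σ τ).2 (by simp [h1, h2]))
      have e4 : c (σ, τ) = 1 := if_pos h1
      simp [e1, e2, e3, e4]
    · have e1 : P σ = 1 := if_pos h1
      have e2 : P τ = J := if_neg h2
      have e3 : P (σ * τ) = J := if_neg (mt (hστ σ τ).1 (by simp [h1, h2]))
      have e4 : c (σ, τ) = 1 := if_pos h1
      simp [e1, e2, e3, e4, hJσ]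
    · have e1 : P σ = J := if_neg h1
      have e2 : P τ = 1 := if_pos h2
      have e3 : P (σ * τ) = J := if_neg (mt (hστ σ τ).1 (by simp [h1, h2]))
      have e4 : c (σ, τ) = 1 := (if_neg h1).trans (if_pos h2)
      simp [e1, e2, e3, e4]
    · have e1 : P σ = J := if_neg h1
      have e2 : P τ = J := if_neg h2
      have e3 : P (σ * τ) = 1 := if_pos ((hστ σ τ).2 (by simp [h1, h2]))
      have e4 : c (σ, τ) = B := (if_neg h1).trans (if_neg h2)
      simp only [e1, e2, e3, e4, hJval, Units.val_one]
      ext i j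
      fin_cases i <;> fin_cases j <;> simp [Matrix.mul_apply, Fin.sum_univ_two, B, hσβ]

end Brauer

/-! ### Quadratic characters and dual families. -/

/-- A homomorphism to a commutative group that is trivial on the common kernel of characters `ε i`
is determined by its values on a dual family `σ i`. -/
theorem MonoidHom.eq_prod_of_dual_family {G Q : Type*} [Group G] [CommGroup Q] (v : G →* Q)
    {m : ℕ} (ε : Fin m → G →* ℤˣ) (σ : Fin m → G)
    (hσ : ∀ i l, ε l (σ i) = if i = l then -1 else 1)
    (hv : ∀ g, (∀ l, ε l g = 1) → v g = 1) (g : G) :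
    v g = ∏ i, if ε i g = 1 then 1 else v (σ i) := by
  -- G need not be commutative, so the product is taken over an ordered list. Duality makes every `ε
  -- l` agree on τ and g, so `g * τ⁻¹` lies in the common kernel and `v g = v τ`.
  set τ : G := (List.ofFn fun i => if ε i g = 1 then 1 else σ i).prod with hτ
  have hvτ : v τ = ∏ i, if ε i g = 1 then 1 else v (σ i) := by
    simp [hτ, map_list_prod, List.prod_ofFn, Function.comp_def, apply_ite]
  have hετ (l : Fin m) : ε l τ = ∏ i, if ε i g = 1 then 1 else ε l (σ i) := by
    simp [hτ, map_list_prod, List.prod_ofFn, Function.comp_def, apply_ite]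
  rw [← hvτ, ← mul_inv_eq_one, ← map_inv, ← map_mul]
  refine hv _ fun l => ?_
  rw [map_mul, map_inv, mul_inv_eq_one, hετ, Finset.prod_eq_single l]
  · rcases Int.units_eq_one_or (ε l g) with h | h <;> simp [h, hσ]
  · intro i _ hi
    simp [hσ, hi]
  · simp

/-- The quadratic character `σ ↦ σ(r) / r` attached to a square root `r` of an element of the base
field. -/
theorem exists_quadraticCharacter {K Ω : Type*} [Field K] [Field Ω] [Algebra K Ω]
    (h2 : (2 : Ω) ≠ 0) (t : Kˣ) (r : Ω) (hr : r ^ 2 = algebraMap K Ω t) :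
    ∃ ε : (Ω ≃ₐ[K] Ω) →* ℤˣ, (∀ g, ε g = 1 ↔ g r = r) ∧ ∀ g, ε g = -1 ↔ g r = -r := by
  classical
  have hr0 : r ≠ 0 := by
    rintro rfl
    exact (map_ne_zero (algebraMap K Ω)).2 t.ne_zero (by rw [← hr]; simp)
  have hrr : -r ≠ r := fun h => by
    have : (2 : Ω) * r = 0 := by linear_combination -h
    rcases mul_eq_zero.1 this with h | h
    exacts [h2 h, hr0 h]
  have hg (g : Ω ≃ₐ[K] Ω) : g r = r ∨ g r = -r :=
    sq_eq_sq_iff_eq_or_eq_neg.1 (by rw [← map_pow, hr, AlgEquiv.commutes])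
  refine ⟨⟨⟨fun g => if g r = r then 1 else -1, by simp⟩, fun g h => ?_⟩, fun g => ?_, fun g => ?_⟩
  · rcases hg g with h1 | h1 <;> rcases hg h with h2 | h2 <;>
      simp [AlgEquiv.mul_apply, h1, h2, hrr]
  · rcases hg g with h1 | h1 <;> simp [h1, hrr]
  · rcases hg g with h1 | h1 <;> simp [h1, hrr, hrr.symm]

/-- E is given as a ring satisfying the proposition `IsField`; a local field structure on it makes
the usual facts about fields available. -/
theorem IsField.ringHom_injective {R S : Type*} [Ring R] [Semiring S] [Nontrivial S]
    (hR : IsField R) (f : R →+* S) : Function.Injective f :=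
  letI := hR.toField
  RingHom.injective f

theorem IsField.eq_or_eq_neg_of_sq_eq_sq {R : Type*} [Ring R] (hR : IsField R) {x y : R}
    (h : x ^ 2 = y ^ 2) : x = y ∨ x = -y :=
  letI := hR.toField
  sq_eq_sq_iff_eq_or_eq_neg.1 h

/-! ### Comparison of the defect of u with a product of Hilbert symbols. -/

section
open GalCoh

/-- With x, y, z the values of u at g, h, gh and p, q, r those of `∏ wᵢ`, the left side is the
quotient of the two cocycles and the right side is the coboundary of `u⁻¹ ∏ wᵢ` for trivial action.
-/
theorem inv_mul_div_eq_mul_div {C : Type*} [CommGroup C] (x y z p q r : C) :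
    (x * y * z⁻¹)⁻¹ * (p * q / r) = y⁻¹ * q * (x⁻¹ * p) / (z⁻¹ * r) := by
  simp only [div_eq_mul_inv, mul_inv_rev, inv_inv]
  simp only [mul_comm, mul_left_comm, mul_assoc]

/-- Let `u : Gal(Ω/K) → Ωˣ` be a homomorphism modulo `Mˣ` that factors through the Galois group of
`K(√t₁, …, √tₘ)`. The 2-cocycle on `Gal(Ω/M)` measuring the failure of `u` to be a homomorphism is
a product of Hilbert symbols. -/
theorem mk_eq_prod_hilbertSymbol {K Ω : Type*} [Field K] [CharZero K] [Field Ω] [Algebra K Ω]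
    [Algebra.IsAlgebraic K Ω] [IsAlgClosed Ω] (M : IntermediateField K Ω)
    (u : (Ω ≃ₐ[K] Ω) → Ωˣ) (hu : IsLocallyConstant u)
    (hmul : ∀ g h, u g * u h * (u (g * h))⁻¹ ∈ (Units.map (algebraMap M Ω : M →* Ω)).range)
    {m : ℕ} (t : Fin m → Kˣ) (s : Fin m → Ω) (hs : ∀ i, s i ^ 2 = algebraMap K Ω (t i))
    (hker : ∀ g : Ω ≃ₐ[K] Ω, (∀ l, g (s l) = s l) →
      u g ∈ (Units.map (algebraMap M Ω : M →* Ω)).range)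
    (σ : Fin m → (Ω ≃ₐ[K] Ω)) (hσ : ∀ i l, σ i (s l) = if i = l then - s l else s l)
    (a : Fin m → Mˣ) (ha : ∀ i, u (σ i) * u (σ i) = Units.map (algebraMap M Ω : M →* Ω) (a i))
    (c : cocycles₂ (galUnits M Ω))
    (hc : ∀ g h : Ω ≃ₐ[M] Ω, c.1 (g, h) = u (AlgEquiv.restrictScalarsHom K g) *
      u (AlgEquiv.restrictScalarsHom K h) *
      (u (AlgEquiv.restrictScalarsHom K g * AlgEquiv.restrictScalarsHom K h))⁻¹) :
    (QuotientGroup.mk c : Br M Ω) =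
      ∏ i, hilbertSymbol M Ω (Units.map (algebraMap K M) (t i)) (a i) := by
  classical
  have : CharZero Ω := charZero_of_injective_algebraMap (algebraMap K Ω).injective
  choose ε hε hε' using fun i => exists_quadraticCharacter two_ne_zero (t i) (s i) (hs i)
  have hεσ (i l : Fin m) : ε l (σ i) = if i = l then -1 else 1 := by
    split_ifs with h
    · rw [hε', hσ, if_pos h]
    · rw [hε, hσ, if_neg h]
  let w (i : Fin m) (g : Ω ≃ₐ[K] Ω) : Ωˣ := if ε i g = 1 then 1 else u (σ i)
  let S : Subgroup Ωˣ := (Units.map (algebraMap M Ω : M →* Ω)).range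
  -- Modulo Mˣ the function u is a genuine homomorphism, which is what `hmul` says; the dual family
  -- then determines it.
  let v : (Ω ≃ₐ[K] Ω) →* Ωˣ ⧸ S := MonoidHom.mk' (fun g => QuotientGroup.mk (u g)) fun g h => by
    rw [← QuotientGroup.mk_mul, eq_comm, ← mul_inv_eq_one, ← QuotientGroup.mk_inv,
      ← QuotientGroup.mk_mul]
    exact (QuotientGroup.eq_one_iff _).2 (hmul g h)
  have hw (g : Ω ≃ₐ[K] Ω) : (u g)⁻¹ * ∏ i, w i g ∈ S := by
    rw [← QuotientGroup.eq]
    have hv (g : Ω ≃ₐ[K] Ω) (hg : ∀ l, ε l g = 1) : v g = 1 :=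
      (QuotientGroup.eq_one_iff _).2 (hker g fun l => (hε l g).1 (hg l))
    have h := MonoidHom.eq_prod_of_dual_family (Q := Ωˣ ⧸ S) v ε σ hεσ hv g
    refine h.trans ?_
    rw [QuotientGroup.mk_prod]
    exact Finset.prod_congr rfl fun i _ => by simp only [w]; split_ifs <;> rfl
  -- The same `s i` serves as square root of `t i` over M. If `t i` becomes a square in M, no
  -- element of Gal(Ω/M) moves `s i` and the cocycle is identically 1, so no separate case is
  -- needed.
  choose q hq hsymb using fun i => exists_cocycle_hilbertSymbol (k := M) (Ω := Ω)
    (Units.map (algebraMap K M : K →* M) (t i)) (a i) (s i) (hs i)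
  simp only [hsymb]
  rw [← QuotientGroup.mk_prod, QuotientGroup.eq]
  let ρ : (Ω ≃ₐ[M] Ω) →* (Ω ≃ₐ[K] Ω) := AlgEquiv.restrictScalarsHom K
  have hρ : Continuous ρ := continuous_restrictScalarsHom _
  -- If at most one of g, h moves `s i`, the factors cancel. If both do, gh fixes it and what
  -- remains is `u(σ i)² = a i`.
  have hqw (i : Fin m) (g h : Ω ≃ₐ[M] Ω) :
      (q i).1 (g, h) = w i (ρ g) * w i (ρ h) / w i (ρ g * ρ h) := by
    have e1 : g (s i) = s i ↔ ε i (ρ g) = 1 := (hε i (ρ g)).symm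
    have e2 : h (s i) = s i ↔ ε i (ρ h) = 1 := (hε i (ρ h)).symm
    rw [hq, ← ha]
    simp only [e1, e2, w, map_mul]
    rcases Int.units_eq_one_or (ε i (ρ g)) with h1 | h1 <;>
      rcases Int.units_eq_one_or (ε i (ρ h)) with h2 | h2 <;> simp [h1, h2]
  have hwl (i : Fin m) : IsLocallyConstant (w i) := by
    have h1 : w i = fun g => if g (s i) = s i then 1 else u (σ i) :=
      funext fun g => by simp only [w, hε]
    rw [h1]
    exact (isLocallyConstant_apply (s i)).comp (fun y => if y = s i then 1 else u (σ i))
  have hwl' : IsLocallyConstant fun g => ∏ i, w i g := by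
    have h1 := hwl
    simp only [IsLocallyConstant.iff_eventually_eq] at h1 ⊢
    intro g
    filter_upwards [Filter.eventually_all.2 fun i => h1 i g] with τ hτ
    exact Finset.prod_congr rfl fun i _ => hτ i
  -- This cochain takes values in Mˣ by `hw`, so Galois acts trivially on it, although u and the `w
  -- i` separately need not be fixed. The twisted coboundary thus reduces to the untwisted one.
  refine ⟨fun g => (u (ρ g))⁻¹ * ∏ i, w i (ρ g),
    (hu.inv.mul hwl').comp_continuous hρ, fun g h => ?_⟩
  have hfix : galUnits M Ω g ((u (ρ h))⁻¹ * ∏ i, w i (ρ h)) =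
      (u (ρ h))⁻¹ * ∏ i, w i (ρ h) := by
    obtain ⟨y, hy⟩ := hw (ρ h)
    rw [← hy]
    exact Units.ext (g.commutes y.val)
  have hprod : (∏ i, q i).1 (g, h) =
      (∏ i, w i (ρ g)) * (∏ i, w i (ρ h)) / ∏ i, w i (ρ g * ρ h) := by
    rw [← Finset.prod_mul_distrib, ← Finset.prod_div_distrib, ← Finset.prod_congr rfl
      fun i _ => hqw i g h]
    simp [Finset.prod_apply]
  rw [hfix]
  change (c.1 (g, h))⁻¹ * (∏ i, q i).1 (g, h) = _
  rw [hprod, hc]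
  exact inv_mul_div_eq_mul_div _ _ _ _ _ _

end

/-! ### The values of α in E and their images in Ω. -/

section
open scoped TensorProduct
open GalCoh CategoryTheory Limits

namespace AbelianVariety
variable {K : Type u} [Field K]

/-- Endomorphisms defined over `K` are fixed by the Galois action. -/
theorem galConj_endBaseChange (A : AbelianVariety K) {L : Type u} [Field L] [Algebra K L]
    (σ : L ≃ₐ[K] L) (f : A.EndRing) :
    A.galConj σ (A.endBaseChange L f) = A.endBaseChange L f := by
  have hproj : (A.endBaseChange L f).hom.left ≫ A.proj L = A.proj L ≫ f.hom.left :=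
    pullback.lift_fst _ _ _
  apply GroupEnd.ext'
  apply Over.OverMorphism.ext
  change A.twist σ ≫ (A.endBaseChange L f).hom.left ≫ A.twist σ⁻¹ = _
  -- The two sides are compared after projecting to A, where the twist becomes invisible, and to
  -- Spec L, where the twists by σ and σ⁻¹ cancel.
  apply A.hom_ext_baseChange
  · rw [Category.assoc, Category.assoc, twist_proj, hproj, ← Category.assoc, twist_proj]
  · rw [Category.assoc, Category.assoc, twist_hom, ← Category.assoc _ (A.baseChange L).X.hom,
      Over.w, ← Category.assoc, twist_hom, Category.assoc, spec_inv_comp, Category.comp_id]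

variable {A : AbelianVariety K} {Ω : Type u} [Field Ω] [Algebra K Ω]

namespace IsConjugator
variable {α : (Ω ≃ₐ[K] Ω) → (A.geomEndAlg Ω)ˣ}

/-- `α(σ)` lies in `E`. -/
theorem mem_rationalEndAlg (hα : IsConjugator α) (hA : A.IsRibetPyle Ω) (σ : Ω ≃ₐ[K] Ω) :
    (α σ).val ∈ A.rationalEndAlg Ω := by
  -- As E is its own centralizer, it suffices to commute with endomorphisms defined over K;
  -- conjugation by `α σ` is the Galois action, which fixes them.
  rw [← hA.centralizer_eq, Subalgebra.mem_centralizer_iff]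
  rintro _ ⟨z, rfl⟩
  induction z using TensorProduct.induction_on with
  | zero => simp
  | add x y hx hy => simp only [map_add, add_mul, mul_add, hx, hy]
  | tmul q f =>
    have h1 : (Algebra.TensorProduct.map (AlgHom.id ℚ ℚ) (A.endBaseChange Ω).toIntAlgHom)
        (q ⊗ₜ[ℤ] f) = q • ((1 : ℚ) ⊗ₜ[ℤ] A.endBaseChange Ω f) := by
      simp [TensorProduct.smul_tmul']
    change (Algebra.TensorProduct.map (AlgHom.id ℚ ℚ) (A.endBaseChange Ω).toIntAlgHom)
        (q ⊗ₜ[ℤ] f) * _ = _ * (Algebra.TensorProduct.map (AlgHom.id ℚ ℚ)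
          (A.endBaseChange Ω).toIntAlgHom) (q ⊗ₜ[ℤ] f)
    rw [h1, smul_mul_assoc, mul_smul_comm, hα.mul_tmul, galConj_endBaseChange]

/-- The image of `α(σ) ∈ Eˣ` in `Ωˣ`. -/
noncomputable def embed (hα : IsConjugator α) (hA : A.IsRibetPyle Ω)
    (j : A.rationalEndAlg Ω →+* Ω) (σ : Ω ≃ₐ[K] Ω) : Ωˣ :=
  Units.mk0 (j ⟨(α σ).val, hα.mem_rationalEndAlg hA σ⟩) fun h => by
    have hz : (α σ).val = 0 := congrArg Subtype.val (IsField.ringHom_injective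
      (R := A.rationalEndAlg Ω) hA.isField j (h.trans (map_zero j).symm))
    -- Simplicity supplies `0 ≠ 1` in X, so that a unit is nonzero.
    have := hA.isSimpleRing
    exact (α σ).ne_zero hz

theorem isLocallyConstant_embed (hα : IsConjugator α) (hA : A.IsRibetPyle Ω)
    (j : A.rationalEndAlg Ω →+* Ω) : IsLocallyConstant (hα.embed hA j) := by
  have h := hα.isLocallyConstant
  rw [IsLocallyConstant.iff_eventually_eq] at h ⊢
  intro σ
  filter_upwards [h σ] with τ hτ
  exact Units.ext (congrArg j (Subtype.ext (congrArg Units.val hτ)))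

/-- The image of `c_α` in Ωˣ is the coboundary of `embed` for trivial action. Since `embed` need not
be Galois-fixed, this does not trivialize the class in the Brauer group. -/
theorem embed_mul_embed (hα : IsConjugator α) (hA : A.IsRibetPyle Ω)
    (j : A.rationalEndAlg Ω →+* Ω) (σ τ : Ω ≃ₐ[K] Ω) :
    hα.embed hA j σ * hα.embed hA j τ * (hα.embed hA j (σ * τ))⁻¹ =
      Units.map (hA.centerEmb j) (hα.cocycleFun (σ, τ)) := by
  rw [mul_inv_eq_iff_eq_mul]
  apply Units.ext
  refine (map_mul j _ _).symm.trans (Eq.trans (congrArg j (Subtype.ext ?_)) (map_mul j _ _))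
  change (α σ).val * (α τ).val =
    (α σ * α τ * (α (σ * τ))⁻¹).val * (α (σ * τ)).val
  rw [← Units.val_mul, ← Units.val_mul, inv_mul_cancel_right]

/-- If `α(σ)²` is the square of an element of `Fˣ`, then `α(σ) ∈ Fˣ`. -/
theorem exists_center_of_mem_kerSq (hα : IsConjugator α) (hA : A.IsRibetPyle Ω)
    {σ : Ω ≃ₐ[K] Ω} (hσ : σ ∈ kerSq α) :
    ∃ y : (A.centerField Ω)ˣ, (y.val : A.geomEndAlg Ω) = (α σ).val := by
  obtain ⟨y, hy⟩ := hσ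
  have h : (⟨(α σ).val, hα.mem_rationalEndAlg hA σ⟩ : A.rationalEndAlg Ω) ^ 2 =
      (⟨(y.val : A.geomEndAlg Ω), hA.centerField_le y.val.2⟩ : A.rationalEndAlg Ω) ^ 2 :=
    Subtype.ext hy
  -- In the field E the only square roots of `y²` are `±y`, and both lie in Fˣ.
  rcases IsField.eq_or_eq_neg_of_sq_eq_sq (R := A.rationalEndAlg Ω) hA.isField h with h | h
  · exact ⟨y, (congrArg Subtype.val h).symm⟩
  · exact ⟨⟨-y.val, -y.inv, Subtype.ext ((neg_mul_neg _ _).trans (congrArg Subtype.val y.val_inv)),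
      Subtype.ext ((neg_mul_neg _ _).trans (congrArg Subtype.val y.inv_val))⟩,
      (congrArg Subtype.val h).symm⟩

/-- If `σ²` lies in the kernel of `α²`, then `α(σ)² ∈ Fˣ`. -/
theorem exists_center_sq (hα : IsConjugator α) (hA : A.IsRibetPyle Ω)
    {σ : Ω ≃ₐ[K] Ω} (hσ : σ * σ ∈ kerSq α) :
    ∃ a : (A.centerField Ω)ˣ, (a.val : A.geomEndAlg Ω) = (α σ).val ^ 2 := by
  obtain ⟨y, hy⟩ := hα.exists_center_of_mem_kerSq hA hσ
  -- `α(σ)² = c_α(σ, σ) α(σ²)`, and both factors are in Fˣ.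
  refine ⟨hα.cocycleFun (σ, σ) * y, ?_⟩
  change (α σ * α σ * (α (σ * σ))⁻¹).val * (y.val : A.geomEndAlg Ω) = _
  rw [hy, ← Units.val_mul, inv_mul_cancel_right, Units.val_mul, sq]

theorem embed_eq_of_eq (hα : IsConjugator α) (hA : A.IsRibetPyle Ω)
    (j : A.rationalEndAlg Ω →+* Ω) {σ : Ω ≃ₐ[K] Ω} {y : (A.centerField Ω)ˣ}
    (hy : (y.val : A.geomEndAlg Ω) = (α σ).val) :
    hα.embed hA j σ = Units.map (hA.centerEmb j : A.centerField Ω →* Ω) y :=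
  Units.ext (congrArg j (Subtype.ext hy.symm))

theorem embed_mul_self (hα : IsConjugator α) (hA : A.IsRibetPyle Ω)
    (j : A.rationalEndAlg Ω →+* Ω) {σ : Ω ≃ₐ[K] Ω} {a : (A.centerField Ω)ˣ}
    (ha : (a.val : A.geomEndAlg Ω) = (α σ).val ^ 2) :
    hα.embed hA j σ * hα.embed hA j σ = Units.map (hA.centerEmb j : A.centerField Ω →* Ω) a :=
  Units.ext ((map_mul j _ _).symm.trans
    (congrArg j (Subtype.ext ((sq _).symm.trans ha.symm))))

/-- Both maps on H² act on representatives, so the image class has a representative that can be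
evaluated pointwise. -/
theorem exists_cocycle_iotaStar_res [Algebra.IsAlgebraic K Ω] (hα : IsConjugator α)
    (hA : A.IsRibetPyle Ω) (j : A.rationalEndAlg Ω →+* Ω) :
    ∃ c : cocycles₂ (galUnits (hA.compositum j) Ω),
      hA.iotaStar j (hA.res j (QuotientGroup.mk hα.cocycle)) = QuotientGroup.mk c ∧
      ∀ g h, c.1 (g, h) = Units.map (hA.centerEmb j : A.centerField Ω →* Ω)
        (hα.cocycleFun (AlgEquiv.restrictScalarsHom K g, AlgEquiv.restrictScalarsHom K h)) :=
  ⟨_, rfl, fun _ _ => rfl⟩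

end IsConjugator
end AbelianVariety
end

/-! ### The theorem. -/

theorem mainTheorem5 {K : Type u} [Field K] [NumberField K]
    {Ω : Type u} [Field Ω] [Algebra K Ω] [Algebra.IsAlgebraic K Ω] [IsAlgClosed Ω]
    (A : AbelianVariety K) (hA : A.IsRibetPyle Ω)
    (j : A.rationalEndAlg Ω →+* Ω)
    (α : (Ω ≃ₐ[K] Ω) → (A.geomEndAlg Ω)ˣ) (hα : AbelianVariety.IsConjugator α)
    (m : ℕ) (t : Fin m → Kˣ) (s : Fin m → Ω)
    (hs : ∀ i, s i ^ 2 = algebraMap K Ω (t i))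
    (hN : ((IntermediateField.adjoin K (Set.range s)).fixingSubgroup : Set (Ω ≃ₐ[K] Ω)) = AbelianVariety.kerSq α)
    (σ : Fin m → (Ω ≃ₐ[K] Ω))
    (hσ : ∀ i l, σ i (s l) = if i = l then - s l else s l) :
    ∃ a : Fin m → (A.centerField Ω)ˣ,
      (∀ i, ((a i).val : A.geomEndAlg Ω) = (α (σ i)).val ^ 2) ∧
      hA.iotaStar j (hA.res j (QuotientGroup.mk hα.cocycle)) =
        ∏ i, hilbertSymbol (hA.compositum j) Ω
          (Units.map (algebraMap K (hA.compositum j)) (t i))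
          (Units.map (hA.centerToCompositum j) (a i)) := by
  have hker (g : Ω ≃ₐ[K] Ω) (hg : ∀ l, g (s l) = s l) : g ∈ AbelianVariety.kerSq α := by
    -- Replacing g by the subgroup it generates lets the Galois connection reduce fixing N to fixing
    -- the generators `s l`.
    rw [← hN, SetLike.mem_coe, ← Subgroup.zpowers_le, ← IntermediateField.le_iff_le,
      IntermediateField.adjoin_le_iff]
    rintro _ ⟨l, rfl⟩
    rw [SetLike.mem_coe, IntermediateField.mem_fixedField_iff]
    exact fun f hf => (Subgroup.zpowers_le (H := MulAction.stabilizer (Ω ≃ₐ[K] Ω) (s l))).2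
      (hg l) hf
  -- `σ i` changes the sign of at most one `s l`, so its square fixes them all and lies in the
  -- kernel of α².
  choose a ha using fun i => hα.exists_center_sq hA (hker (σ i * σ i) fun l => by
    rw [AlgEquiv.mul_apply, hσ]
    split_ifs with h <;> simp [hσ, h])
  refine ⟨a, ha, ?_⟩
  have hmap (y : (A.centerField Ω)ˣ) : Units.map (hA.centerEmb j : A.centerField Ω →* Ω) y ∈
      (Units.map (algebraMap (hA.compositum j) Ω : hA.compositum j →* Ω)).range :=
    ⟨Units.map (hA.centerToCompositum j) y, rfl⟩
  obtain ⟨c, hc, hcg⟩ := hα.exists_cocycle_iotaStar_res hA j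
  rw [hc]
  have hmul (g h : Ω ≃ₐ[K] Ω) : hα.embed hA j g * hα.embed hA j h * (hα.embed hA j (g * h))⁻¹ ∈
      (Units.map (algebraMap (hA.compositum j) Ω : hA.compositum j →* Ω)).range := by
    rw [hα.embed_mul_embed]
    exact hmap _
  have hu (g : Ω ≃ₐ[K] Ω) (hg : ∀ l, g (s l) = s l) : hα.embed hA j g ∈
      (Units.map (algebraMap (hA.compositum j) Ω : hA.compositum j →* Ω)).range := by
    obtain ⟨y, hy⟩ := hα.exists_center_of_mem_kerSq hA (hker g hg)
    rw [hα.embed_eq_of_eq hA j hy]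
    exact hmap y
  have hsq (i : Fin m) := hα.embed_mul_self hA j (ha i)
  have key := mk_eq_prod_hilbertSymbol (hA.compositum j) (hα.embed hA j)
    (hα.isLocallyConstant_embed hA j) hmul t s hs hu σ hσ
    fun i => Units.map (hA.centerToCompositum j) (a i)
  exact key hsq c fun g h => by rw [hα.embed_mul_embed, hcg]
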